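/- Theorem 3.5 (bilateral shifts on $\ell^p(\mathbb{Z})$, $c_0(\mathbb{Z})$ and their weighted versions). Let $v=(v_n)_{n\in\mathbb{Z}}$ be a sequence of strictly positive real numbers and let $1\le p<\infty$. Let $X$ be one of the following complex Banach spaces of sequences $x=(x_n)_{n\in\mathbb{Z}}$ of complex numbers: - $\ell^p(\mathbb{Z})=\{x:\sum_{n\in\mathbb{Z}}|x_n|^p<\infty\}$ with $\|x\|=\big(\sum_n|x_n|^p\big)^{1/p}$; - $c_0(\mathbb{Z})=\{x:\lim_{n\to\pm\infty}|x_n|=0\}$ with $\|x\|=\sup_n|x_n|$; - $\ell^p(v,\mathbb{Z})=\{x:\sum_{n\in\mathbb{Z}}|x_n|^pv_n<\infty\}$ with $\|x\|=\big(\sum_n|x_n|^pv_n\big)^{1/p}$; - $c_0(v,\mathbb{Z})=\{x:\lim_{n\to\pm\infty}|x_n|v_n=0\}$ with $\|x\|=\sup_n|x_n|v_n$. Let $(e_n)_{n\in\mathbb{Z}}$ be the canonical unit vectors of $X$, and let $T:X\to X$ be a bilateral weighted shift, that is, a continuous linear operator for which there are complex scalars $(w_n)_{n\in\mathbb{Z}}$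 with $Te_n=w_ne_{n-1}$ for every $n\in\mathbb{Z}$. Suppose that $T$ is hypercyclic, that is, there is a vector $x\in X$ (a hypercyclic vector for $T$) such that $\{T^nx:n\ge 1\}$ is dense in $X$. Then $T$ has a hypercyclic subspace: there is a closed infinite-dimensional linear subspace $M\subset X$ such that every nonzero vector of $M$ is a hypercyclic vector for $T$. -/

import Mathlib

open scoped NNReal ENNReal ZeroAtInfty Topology

noncomputable section

/-! ### Hypercyclicity -/

section Hypercyclicity

variable {X : Type*} [AddCommGroup X] [Module ℂ X] [TopologicalSpace X]

/-- `x` is a hypercyclic vector for `T` if `{T ^ n x : n ≥ 1}` is dense. -/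
def IsHypercyclicVector (T : X →L[ℂ] X) (x : X) : Prop :=
  Dense {y : X | ∃ n : ℕ, 1 ≤ n ∧ y = (T ^ n) x}

/-- A continuous linear operator is hypercyclic if it has a hypercyclic vector. -/
def IsHypercyclic (T : X →L[ℂ] X) : Prop :=
  ∃ x : X, IsHypercyclicVector T x

/-- `T` has a hypercyclic subspace: a closed infinite-dimensional linear subspace all of whose
nonzero vectors are hypercyclic for `T`. -/
def HasHypercyclicSubspace (T : X →L[ℂ] X) : Prop :=
  ∃ M : Submodule ℂ X, IsClosed (M : Set X) ∧ ¬ FiniteDimensional ℂ M ∧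
    ∀ x ∈ M, x ≠ 0 → IsHypercyclicVector T x

/-- `T` is the bilateral weighted (backward) shift with weights `w` with respect to the family
`e`: `T (e n) = w n • e (n - 1)` for every integer `n`. -/
def IsBilateralWeightedShift (e : ℤ → X) (w : ℤ → ℂ) (T : X →L[ℂ] X) : Prop :=
  ∀ n : ℤ, T (e n) = w n • e (n - 1)

end Hypercyclicity

/-! ### The spaces `ℓ^p(ℤ)` and `c₀(ℤ)`

These are Mathlib's `lp (fun _ : ℤ => ℂ) p` and `C₀(ℤ, ℂ)`. -/

/-- The canonical unit vectors of `ℓ^p(ℤ)`. -/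
def lpUnit (p : ℝ≥0∞) (n : ℤ) : lp (fun _ : ℤ => ℂ) p :=
  lp.single p n 1

/-- The canonical unit vectors of `c₀(ℤ)`. -/
def c0Unit (n : ℤ) : C₀(ℤ, ℂ) where
  toFun := Pi.single n 1
  continuous_toFun := continuous_of_discreteTopology
  zero_at_infty' := by
    rw [Filter.cocompact_eq_cofinite]
    refine tendsto_const_nhds.congr' ?_
    filter_upwards [Filter.eventually_cofinite_ne n] with k hk
    simp [hk]

/-! ### The weighted space `ℓ^p(v, ℤ)` -/

theorem norm_weight_smul_rpow {p : ℝ≥0} (hp : 1 ≤ (p : ℝ≥0∞)) {a : ℝ} (ha : 0 < a) (z : ℂ) :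
    ‖((a ^ (1 / (p : ℝ)) : ℝ) : ℂ) * z‖ ^ (p : ℝ) = ‖z‖ ^ (p : ℝ) * a := by
  have hp0 : (p : ℝ) ≠ 0 := by
    have h1 : (1 : ℝ≥0) ≤ p := by exact_mod_cast hp
    have h2 : (1 : ℝ) ≤ p := by exact_mod_cast h1
    linarith
  have h : 0 ≤ a ^ (1 / (p : ℝ)) := Real.rpow_nonneg ha.le _
  rw [norm_mul, Complex.norm_real, Real.norm_of_nonneg h, Real.mul_rpow h (norm_nonneg _),
    ← Real.rpow_mul ha.le, one_div_mul_cancel hp0, Real.rpow_one, mul_comm]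

theorem memℓp_weight_iff {p : ℝ≥0} [Fact (1 ≤ (p : ℝ≥0∞))] {v : ℤ → ℝ} (hv : ∀ n, 0 < v n)
    (x : ℤ → ℂ) :
    Memℓp (fun n => ((v n ^ (1 / (p : ℝ)) : ℝ) : ℂ) * x n) (p : ℝ≥0∞) ↔
      Summable fun n => ‖x n‖ ^ (p : ℝ) * v n := by
  have hp : 1 ≤ (p : ℝ≥0∞) := Fact.out
  have hp0 : 0 < (p : ℝ≥0∞).toReal :=
    ENNReal.toReal_pos (zero_lt_one.trans_le hp).ne' ENNReal.coe_ne_top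
  rw [memℓp_gen_iff hp0]
  simp only [ENNReal.coe_toReal, norm_weight_smul_rpow hp (hv _)]

/-- The sequences `x` with `∑ |x n| ^ p * v n < ∞`. -/
def weightedLpSubmodule (p : ℝ≥0) [Fact (1 ≤ (p : ℝ≥0∞))] {v : ℤ → ℝ} (hv : ∀ n, 0 < v n) :
    Submodule ℂ (ℤ → ℂ) where
  carrier := {x | Summable fun n => ‖x n‖ ^ (p : ℝ) * v n}
  zero_mem' := by
    refine (memℓp_weight_iff hv 0).1 ?_
    simpa using (zero_mem_ℓp' (E := fun _ : ℤ => ℂ) (p := (p : ℝ≥0∞)))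
  add_mem' := by
    intro x y hx hy
    refine (memℓp_weight_iff hv (x + y)).1 ?_
    convert ((memℓp_weight_iff hv x).2 hx).add ((memℓp_weight_iff hv y).2 hy) using 1
    funext n
    simp [mul_add]
  smul_mem' := by
    intro c x hx
    refine (memℓp_weight_iff hv (c • x)).1 ?_
    convert ((memℓp_weight_iff hv x).2 hx).const_smul c using 1
    funext n
    simp [mul_left_comm]

/-- The space `ℓ^p(v, ℤ)` of complex sequences with `∑ |x n| ^ p * v n < ∞`, for a strictly
positive weight `v`. -/
def WeightedLp (p : ℝ≥0) [Fact (1 ≤ (p : ℝ≥0∞))] {v : ℤ → ℝ} (hv : ∀ n, 0 < v n) : Type :=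
  weightedLpSubmodule p hv

namespace WeightedLp

variable {p : ℝ≥0} [Fact (1 ≤ (p : ℝ≥0∞))] {v : ℤ → ℝ} {hv : ∀ n, 0 < v n}

instance : AddCommGroup (WeightedLp p hv) :=
  inferInstanceAs (AddCommGroup (weightedLpSubmodule p hv))

instance : Module ℂ (WeightedLp p hv) :=
  inferInstanceAs (Module ℂ (weightedLpSubmodule p hv))

/-- The underlying sequence. -/
def coords (x : WeightedLp p hv) : ℤ → ℂ := x.1

/-- The linear map `x ↦ (v n ^ (1 / p) * x n)` into `ℓ^p(ℤ)`. -/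
def toLp : WeightedLp p hv →ₗ[ℂ] lp (fun _ : ℤ => ℂ) (p : ℝ≥0∞) where
  toFun x := ⟨fun n => ((v n ^ (1 / (p : ℝ)) : ℝ) : ℂ) * x.coords n,
    (memℓp_weight_iff hv x.coords).2 x.2⟩
  map_add' x y := by
    ext n
    exact mul_add _ _ _
  map_smul' c x := by
    ext n
    exact mul_left_comm _ _ _

theorem toLp_injective : Function.Injective (toLp (p := p) (hv := hv)) := by
  intro x y h
  refine Subtype.ext (funext fun n => ?_)
  have h1 : ((v n ^ (1 / (p : ℝ)) : ℝ) : ℂ) * x.1 n = ((v n ^ (1 / (p : ℝ)) : ℝ) : ℂ) * y.1 n :=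
    congrFun (congrArg (fun z : lp (fun _ : ℤ => ℂ) (p : ℝ≥0∞) => (z : ℤ → ℂ)) h) n
  refine mul_left_cancel₀ ?_ h1
  exact_mod_cast (Real.rpow_pos_of_pos (hv n) _).ne'

theorem norm_toLp (x : WeightedLp p hv) :
    ‖toLp x‖ = (∑' n, ‖x.coords n‖ ^ (p : ℝ) * v n) ^ (1 / (p : ℝ)) := by
  have hp : 1 ≤ (p : ℝ≥0∞) := Fact.out
  have hp0 : 0 < (p : ℝ≥0∞).toReal :=
    ENNReal.toReal_pos (zero_lt_one.trans_le hp).ne' ENNReal.coe_ne_top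
  rw [lp.norm_eq_tsum_rpow hp0, ENNReal.coe_toReal]
  congr 1
  exact tsum_congr fun n => norm_weight_smul_rpow hp (hv n) _

/-- The norm `‖x‖ = (∑ |x n| ^ p * v n) ^ (1 / p)`. -/
instance : NormedAddCommGroup (WeightedLp p hv) :=
  AddGroupNorm.toNormedAddCommGroup
    { toFun := fun x => (∑' n, ‖x.coords n‖ ^ (p : ℝ) * v n) ^ (1 / (p : ℝ))
      map_zero' := by rw [← norm_toLp, map_zero, norm_zero]
      add_le' := fun x y => by
        simpa only [← norm_toLp, map_add] using norm_add_le (toLp x) (toLp y)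
      neg' := fun x => by rw [← norm_toLp, ← norm_toLp, map_neg, norm_neg]
      eq_zero_of_map_eq_zero' := fun x hx => by
        rw [← norm_toLp, norm_eq_zero] at hx
        exact toLp_injective (hx.trans (map_zero _).symm) }

theorem norm_def (x : WeightedLp p hv) :
    ‖x‖ = (∑' n, ‖x.coords n‖ ^ (p : ℝ) * v n) ^ (1 / (p : ℝ)) := rfl

instance : NormedSpace ℂ (WeightedLp p hv) where
  norm_smul_le c x := by
    rw [norm_def, norm_def, ← norm_toLp, ← norm_toLp, map_smul]
    exact norm_smul_le c (toLp x)

/-- The canonical unit vectors of `ℓ^p(v, ℤ)`. -/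
def unit (p : ℝ≥0) [Fact (1 ≤ (p : ℝ≥0∞))] {v : ℤ → ℝ} (hv : ∀ n, 0 < v n) (n : ℤ) :
    WeightedLp p hv :=
  ⟨Pi.single n 1, by
    have hp : 1 ≤ (p : ℝ≥0∞) := Fact.out
    have hp0 : (p : ℝ) ≠ 0 := by
      have h1 : (1 : ℝ≥0) ≤ p := by exact_mod_cast hp
      have h2 : (1 : ℝ) ≤ p := by exact_mod_cast h1
      linarith
    refine summable_of_ne_finset_zero (s := {n}) fun k hk => ?_
    have hk' : k ≠ n := by simpa using hk
    simp [hk', Real.zero_rpow hp0]⟩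

end WeightedLp

/-! ### The weighted space `c₀(v, ℤ)` -/

/-- The sequences `x` with `|x n| * v n → 0` as `n → ±∞`. -/
def weightedC0Submodule {v : ℤ → ℝ} (hv : ∀ n, 0 < v n) : Submodule ℂ (ℤ → ℂ) where
  carrier := {x | Filter.Tendsto (fun n => ‖x n‖ * v n) (Filter.atBot ⊔ Filter.atTop) (𝓝 0)}
  zero_mem' := by simp
  add_mem' := by
    intro x y hx hy
    refine squeeze_zero (fun n => mul_nonneg (norm_nonneg _) (hv n).le) (fun n => ?_)
      (by simpa using Filter.Tendsto.add hx hy)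
    rw [← add_mul]
    exact mul_le_mul_of_nonneg_right (norm_add_le _ _) (hv n).le
  smul_mem' := by
    intro c x hx
    have h := Filter.Tendsto.const_mul ‖c‖ hx
    simpa [mul_assoc] using h

/-- The space `c₀(v, ℤ)` of complex sequences with `|x n| * v n → 0` as `n → ±∞`, for a strictly
positive weight `v`. -/
def WeightedC0 {v : ℤ → ℝ} (hv : ∀ n, 0 < v n) : Type :=
  weightedC0Submodule hv

namespace WeightedC0

variable {v : ℤ → ℝ} {hv : ∀ n, 0 < v n}

instance : AddCommGroup (WeightedC0 hv) :=
  inferInstanceAs (AddCommGroup (weightedC0Submodule hv))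

instance : Module ℂ (WeightedC0 hv) :=
  inferInstanceAs (Module ℂ (weightedC0Submodule hv))

/-- The underlying sequence. -/
def coords (x : WeightedC0 hv) : ℤ → ℂ := x.1

theorem norm_weight_mul (hv : ∀ n, 0 < v n) (x : ℤ → ℂ) (n : ℤ) :
    ‖(v n : ℂ) * x n‖ = ‖x n‖ * v n := by
  rw [norm_mul, Complex.norm_real, Real.norm_of_nonneg (hv n).le, mul_comm]

/-- The linear map `x ↦ (v n * x n)` into `c₀(ℤ)`. -/
def toC0 : WeightedC0 hv →ₗ[ℂ] C₀(ℤ, ℂ) where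
  toFun x :=
    { toFun := fun n => (v n : ℂ) * x.coords n
      continuous_toFun := continuous_of_discreteTopology
      zero_at_infty' := by
        rw [Filter.cocompact_eq_cofinite, Int.cofinite_eq, tendsto_zero_iff_norm_tendsto_zero]
        simp only [norm_weight_mul hv]
        exact x.2 }
  map_add' x y := by
    ext n
    exact mul_add _ _ _
  map_smul' c x := by
    ext n
    exact mul_left_comm _ _ _

theorem toC0_injective : Function.Injective (toC0 (hv := hv)) := by
  intro x y h
  refine Subtype.ext (funext fun n => ?_)
  have h1 : (v n : ℂ) * x.1 n = (v n : ℂ) * y.1 n := DFunLike.congr_fun h n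
  refine mul_left_cancel₀ ?_ h1
  exact_mod_cast (hv n).ne'

theorem norm_toC0 (x : WeightedC0 hv) : ‖toC0 x‖ = ⨆ n, ‖x.coords n‖ * v n := by
  rw [← ZeroAtInftyContinuousMap.norm_toBCF_eq_norm, BoundedContinuousFunction.norm_eq_iSup_norm]
  exact iSup_congr fun n => norm_weight_mul hv _ n

/-- The norm `‖x‖ = sup |x n| * v n`. -/
instance : NormedAddCommGroup (WeightedC0 hv) :=
  AddGroupNorm.toNormedAddCommGroup
    { toFun := fun x => ⨆ n, ‖x.coords n‖ * v n
      map_zero' := by rw [← norm_toC0, map_zero, norm_zero]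
      add_le' := fun x y => by
        simpa only [← norm_toC0, map_add] using norm_add_le (toC0 x) (toC0 y)
      neg' := fun x => by rw [← norm_toC0, ← norm_toC0, map_neg, norm_neg]
      eq_zero_of_map_eq_zero' := fun x hx => by
        rw [← norm_toC0, norm_eq_zero] at hx
        exact toC0_injective (hx.trans (map_zero _).symm) }

theorem norm_def (x : WeightedC0 hv) : ‖x‖ = ⨆ n, ‖x.coords n‖ * v n := rfl

instance : NormedSpace ℂ (WeightedC0 hv) where
  norm_smul_le c x := by
    rw [norm_def, norm_def, ← norm_toC0, ← norm_toC0, map_smul]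
    exact norm_smul_le c (toC0 x)

/-- The canonical unit vectors of `c₀(v, ℤ)`. -/
def unit {v : ℤ → ℝ} (hv : ∀ n, 0 < v n) (n : ℤ) : WeightedC0 hv :=
  ⟨Pi.single n 1, by
    change Filter.Tendsto _ _ _
    rw [← Int.cofinite_eq]
    refine tendsto_const_nhds.congr' ?_
    filter_upwards [Filter.eventually_cofinite_ne n] with k hk
    simp [hk]⟩

end WeightedC0

end

/-! Bounded weights and the translation-invariant norm allow a direct construction. Hypercyclicity
makes some weight products very small and others very large (`exists_weightProd_small`), so along
suitable powers finitely supported vectors tend to zero and also have preimages tending to zero.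

Indices `m i` moving to the left, powers `n k` and vectors `z k` are then chosen together: each `T ^
n k` maps every `e (m i)` into the unit ball, and for fixed `i` these images tend to zero. By
`norm_pow_le_of_mem` all these powers are contractions on the closed span `E` of the `e (m i)`,
hence tend to zero pointwise there. The delicate point is that a new index must respect all earlier
powers; `exists_weightProd_le_one` provides it.

The subspace `E` itself contains no hypercyclic behaviour along `n k`, but the small operator `K`,
built from the coordinates and the `z k`, adds it: for nonzero `x` in `E`, some nonzero coordinate
multiplies every vector of a dense sequence in the limit set of `T ^ n k` applied to `x + K x`.
Since `1 + K` is invertible, the image of `E` is closed and infinite-dimensional. The weighted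
spaces are isometric to the unweighted ones by a diagonal map. -/

open Filter

/-! ### Perturbing a subspace on which powers tend to zero. -/

section Criterion

variable {X : Type*} [NormedAddCommGroup X] [NormedSpace ℂ X]

/-- Scaling by a nonzero `c` is a homeomorphism, so the limit points `c • d l` of the orbit are
already dense. -/
theorem dense_orbit_of_tendsto {T : X →L[ℂ] X} {x : X} {n : ℕ → ℕ} (hn : ∀ k, 1 ≤ n k)
    {d : ℕ → X} (hd : DenseRange d) {c : ℂ} (hc : c ≠ 0)
    (h : ∀ l, ∃ κ : ℕ → ℕ, Tendsto (fun r => (T ^ n (κ r)) x) atTop (𝓝 (c • d l))) :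
    IsHypercyclicVector T x := by
  have hcd : DenseRange fun l => c • d l :=
    (Homeomorph.smulOfNeZero c hc).surjective.denseRange.comp hd (continuous_const_smul c)
  refine dense_closure.1 (hcd.mono ?_)
  rintro _ ⟨l, rfl⟩
  obtain ⟨κ, hκ⟩ := h l
  exact mem_closure_of_tendsto hκ (Eventually.of_forall fun r => ⟨n (κ r), hn _, rfl⟩)

theorem hasSum_half_pow_succ : HasSum (fun j : ℕ => ((1 : ℝ) / 2) ^ (j + 1)) 1 := by
  simpa [pow_succ] using hasSum_geometric_two.mul_right (1 / 2 : ℝ)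

theorem hasSum_quarter_pow_succ : HasSum (fun j : ℕ => ((1 : ℝ) / 4) ^ (j + 1)) (1 / 3) := by
  have := (hasSum_geometric_of_lt_one (r := (1 / 4 : ℝ)) (by norm_num) (by norm_num)).mul_right
    (1 / 4 : ℝ)
  norm_num [pow_succ] at this ⊢
  exact this

variable [CompleteSpace X]

/-- If `T ^ n k` tends to zero pointwise on an infinite-dimensional closed subspace `E`, and the
vectors `z k` are small with `(T ^ n k) (z k)` running infinitely often, for each functional `φ i`,
through a dense sequence, then the perturbation `x ↦ x + ∑ k, φ (i k) x • z k` maps `E` onto a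
hypercyclic subspace. -/
theorem hasHypercyclicSubspace_of_perturbation {T : X →L[ℂ] X} {E : Submodule ℂ X}
    (hEc : IsClosed (E : Set X)) (hE : ¬ FiniteDimensional ℂ E) {φ : ℕ → X →L[ℂ] ℂ}
    (hφ : ∀ i x, ‖φ i x‖ ≤ ‖x‖) (hsep : ∀ x ∈ E, (∀ i, φ i x = 0) → x = 0)
    {n : ℕ → ℕ} (hn : ∀ k, 1 ≤ n k)
    (hT : ∀ x ∈ E, Tendsto (fun k => (T ^ n k) x) atTop (𝓝 0))
    {d : ℕ → X} (hd : DenseRange d) {z : ℕ → X} (hz : ∀ k, ‖z k‖ ≤ (1 / 4) ^ (k + 1))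
    (hhit : ∀ k, (T ^ n k) (z k) = d k.unpair.2.unpair.1)
    (hsmall : ∀ j k, j ≠ k → ‖(T ^ n k) (z j)‖ ≤ (1 / 2) ^ (k + 1) * (1 / 2) ^ (j + 1)) :
    HasHypercyclicSubspace T := by
  have hφz : ∀ k, ‖(φ k.unpair.1).smulRight (z k)‖ ≤ (1 / 4 : ℝ) ^ (k + 1) := fun k => by
    rw [ContinuousLinearMap.norm_smulRight_apply]
    have h1 : ‖φ k.unpair.1‖ ≤ 1 :=
      ContinuousLinearMap.opNorm_le_bound _ zero_le_one fun x => by simpa using hφ _ x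
    calc _ ≤ 1 * (1 / 4 : ℝ) ^ (k + 1) := by
          gcongr
          exact hz k
      _ = _ := one_mul _
  set K : X →L[ℂ] X := ∑' k, (φ k.unpair.1).smulRight (z k) with hK
  have hKsum : HasSum (fun k => (φ k.unpair.1).smulRight (z k)) K :=
    (Summable.of_norm_bounded hasSum_quarter_pow_succ.summable hφz).hasSum
  have hKnorm : ‖K‖ < 1 :=
    (tsum_of_norm_bounded hasSum_quarter_pow_succ hφz).trans_lt (by norm_num)
  have hTK : ∀ k x, ‖(T ^ n k) (K x) - φ k.unpair.1 x • d k.unpair.2.unpair.1‖ ≤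
      ‖x‖ * (1 / 2) ^ (k + 1) := fun k x => by
    have h1 : HasSum (fun j => φ j.unpair.1 x • (T ^ n k) (z j)) ((T ^ n k) (K x)) := by
      simpa using (T ^ n k).hasSum ((ContinuousLinearMap.apply ℂ X x).hasSum hKsum)
    -- Removing the main term at `j = k` leaves only cross terms, which `hsmall` sums to at most
    -- `‖x‖ * (1 / 2) ^ (k + 1)`.
    have h2 := h1.sub (hasSum_ite_eq k (φ k.unpair.1 x • d k.unpair.2.unpair.1))
    refine h2.norm_le_of_bounded
      (by simpa only [mul_one] using hasSum_half_pow_succ.mul_left (‖x‖ * (1 / 2) ^ (k + 1))) fun j => ?_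
    by_cases hj : j = k
    · subst hj
      rw [if_pos rfl, hhit, sub_self, norm_zero]
      positivity
    · rw [if_neg hj, sub_zero, norm_smul, mul_assoc]
      exact mul_le_mul (hφ _ _) (hsmall j k hj) (norm_nonneg _) (norm_nonneg _)
  -- `1 + K` is invertible by the Neumann series, as `‖K‖ ≤ 1 / 3`.
  let U : X ≃L[ℂ] X := ContinuousLinearEquiv.unitsEquiv ℂ X
    (Units.oneSub (-K) (by rwa [norm_neg]))
  have hU : ∀ x, U x = x + K x := fun x => by
    change (1 - -K) x = _
    simp
  refine ⟨E.map (U : X →ₗ[ℂ] X), ?_, fun h => hE ?_, ?_⟩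
  · rw [Submodule.map_coe]
    exact U.toHomeomorph.isClosed_image.2 hEc
  · exact Module.Finite.equiv (U.toLinearEquiv.submoduleMap E).symm
  · rintro _ ⟨x, hx, rfl⟩ hx0
    change IsHypercyclicVector T (U x)
    obtain ⟨i, hi⟩ : ∃ i, φ i x ≠ 0 := by
      by_contra! h
      exact hx0 (by rw [hsep x hx h]; exact map_zero U)
    -- The index `k` encodes a triple: which functional, which target, and a free parameter `r` that
    -- repeats the pair infinitely often.
    refine dense_orbit_of_tendsto hn hd hi fun l => ⟨fun r => Nat.pair i (Nat.pair l r), ?_⟩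
    have hκ : Tendsto (fun r => Nat.pair i (Nat.pair l r)) atTop atTop :=
      tendsto_atTop_mono
        (fun r => (Nat.right_le_pair l r).trans (Nat.right_le_pair i _)) tendsto_id
    have hlim : Tendsto (fun r => (T ^ n (Nat.pair i (Nat.pair l r))) (K x) - φ i x • d l)
        atTop (𝓝 0) := by
      refine squeeze_zero_norm (a := fun r => ‖x‖ * (1 / 2) ^ (Nat.pair i (Nat.pair l r) + 1))
        (fun r => by simpa using hTK (Nat.pair i (Nat.pair l r)) x) ?_
      simpa using ((hasSum_half_pow_succ.summable.tendsto_atTop_zero.comp hκ).const_mul ‖x‖)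
    have := (((hT x hx).comp hκ).add hlim).add_const (φ i x • d l)
    simpa [hU, Function.comp_def, add_assoc] using this

end Criterion

/-- Recursive choice in which each new term is compared with the finite set of all earlier ones. -/
theorem exists_seq_forall_finset {α : Type*} (R : ℕ → α → Prop) (r : ℕ → α → α → Prop)
    (h : ∀ (k : ℕ) (s : Finset α), ∃ y, R k y ∧ ∀ x ∈ s, r k x y) :
    ∃ f : ℕ → α, (∀ k, R k (f k)) ∧ ∀ j k, j < k → r k (f j) (f k) := by
  classical
  choose g hg hr using h
  let s : ℕ → Finset α := fun k => Nat.rec ∅ (fun k s => insert (g k s) s) k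
  have hs : ∀ k, s (k + 1) = insert (g k (s k)) (s k) := fun k => rfl
  have hmono : Monotone s := monotone_nat_of_le_succ fun k => by
    rw [hs]
    exact Finset.subset_insert _ _
  refine ⟨fun k => g k (s k), fun k => hg _ _, fun j k hjk => hr _ _ _ (hmono hjk ?_)⟩
  rw [Nat.succ_eq_add_one, hs]
  exact Finset.mem_insert_self _ _

/-! ### Weighted shifts with respect to a shift-invariant unconditional basis -/

/-- The product of `n` consecutive weights `w m * w (m - 1) * ⋯ * w (m - n + 1)`. -/
noncomputable def weightProd (w : ℤ → ℂ) (m : ℤ) (n : ℕ) : ℂ := ∏ s ∈ Finset.range n, w (m - s)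

theorem weightProd_add (w : ℤ → ℂ) (m : ℤ) (a b : ℕ) :
    weightProd w m (a + b) = weightProd w m a * weightProd w (m - a) b := by
  simp [weightProd, Finset.prod_range_add, sub_sub]

theorem norm_weightProd_le {w : ℤ → ℂ} {C : ℝ} (hw : ∀ n, ‖w n‖ ≤ C) (m : ℤ) (n : ℕ) :
    ‖weightProd w m n‖ ≤ C ^ n := by
  rw [weightProd, norm_prod]
  exact (Finset.prod_le_prod (fun _ _ => norm_nonneg _) fun _ _ => hw _).trans_eq (by simp)

/-- If the weights are bounded and the products of weights starting at arbitrarily negative indices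
are not bounded below, then arbitrarily far to the left there are indices at which
finitely many prescribed products have modulus at most one. -/
theorem exists_weightProd_le_one {w : ℤ → ℂ} {C : ℝ} (hw : ∀ n, ‖w n‖ ≤ C)
    (hsmall : ∀ (m : ℤ) (ε : ℝ), 0 < ε → ∃ n, ‖weightProd w m n‖ < ε)
    (A : Finset ℕ) (hA : ∀ n ∈ A, 1 ≤ n) (M : ℤ) :
    ∃ m < M, ∀ n ∈ A, ‖weightProd w m n‖ ≤ 1 := by
  by_contra! hcon
  set D : ℝ := max C 1 with hD
  have hD1 : 1 ≤ D := le_max_right _ _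
  have hwD : ∀ n, ‖w n‖ ≤ D := fun n => (hw n).trans (le_max_left _ _)
  have hDpos : 0 < D ^ A.sup id := by positivity
  -- If the claim fails, every `m < M` starts a block of length in `A` with product of modulus above
  -- one. Concatenating blocks leftwards bounds products of every length below; an incomplete last
  -- block costs at most `D ^ A.sup id`. This contradicts `hsmall`.
  have key : ∀ N : ℕ, ∀ m < M, 1 ≤ ‖weightProd w m N‖ * D ^ A.sup id := by
    intro N
    induction N using Nat.strong_induction_on with
    | _ N ih =>
      intro m hm
      obtain ⟨n, hnA, hn⟩ := hcon m hm
      have hn1 := hA n hnA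
      rcases le_or_gt n N with hle | hlt
      · obtain ⟨b, rfl⟩ := Nat.exists_eq_add_of_le hle
        have h := ih b (by omega) (m - n) (by omega)
        rw [weightProd_add, norm_mul, mul_assoc]
        nlinarith
      · obtain ⟨b, rfl⟩ := Nat.exists_eq_add_of_lt hlt
        rw [add_assoc, weightProd_add, norm_mul] at hn
        refine hn.le.trans (mul_le_mul_of_nonneg_left ?_ (norm_nonneg _))
        refine (norm_weightProd_le hwD _ _).trans (pow_le_pow_right₀ hD1 ?_)
        have : N + b + 1 ≤ A.sup id := Finset.le_sup (f := id) hnA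
        omega
  obtain ⟨N, hN⟩ := hsmall (M - 1) (D ^ A.sup id)⁻¹ (by positivity)
  have h1 := key N (M - 1) (by omega)
  have h2 := mul_lt_mul_of_pos_right hN hDpos
  rw [inv_mul_cancel₀ hDpos.ne'] at h2
  linarith

section ShiftBasis

variable {X : Type*} [NormedAddCommGroup X] [NormedSpace ℂ X]

/-- A normalized family `e` indexed by `ℤ`, with dense span and coordinate functionals `φ`, for
which the norm is monotone in the moduli of the coordinates and invariant under translation. -/
structure IsShiftBasis (e : ℤ → X) (φ : ℤ → X →L[ℂ] ℂ) : Prop where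
  coord_unit_self : ∀ n, φ n (e n) = 1
  coord_unit_ne : ∀ m n, m ≠ n → φ m (e n) = 0
  norm_unit : ∀ n, ‖e n‖ = 1
  norm_coord_le : ∀ n x, ‖φ n x‖ ≤ ‖x‖
  dense_span : Dense (Submodule.span ℂ (Set.range e) : Set X)
  norm_le_norm : ∀ (k : ℤ) (x y : X), (∀ n, ‖φ n x‖ ≤ ‖φ (n + k) y‖) → ‖x‖ ≤ ‖y‖

theorem IsBilateralWeightedShift.pow_apply {e : ℤ → X} {w : ℤ → ℂ} {T : X →L[ℂ] X}
    (hT : IsBilateralWeightedShift e w T) (m : ℤ) (n : ℕ) :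
    (T ^ n) (e m) = weightProd w m n • e (m - n) := by
  induction n with
  | zero => simp [weightProd]
  | succ n ih =>
    rw [pow_succ', mul_apply_eq_comp, ih, map_smul, hT, smul_smul, weightProd_add,
      Nat.cast_add, Nat.cast_one, ← sub_sub]
    simp [weightProd]

namespace IsShiftBasis

variable {e : ℤ → X} {φ : ℤ → X →L[ℂ] ℂ} {w : ℤ → ℂ} {T : X →L[ℂ] X}

theorem eq_zero (h : IsShiftBasis e φ) {x : X} (hx : ∀ n, φ n x = 0) : x = 0 := by
  have := h.norm_le_norm 0 x 0 fun n => by simp [hx n]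
  simpa using this

/-- Both sides are continuous functionals of `x`, so it suffices to compare them on the unit
vectors. -/
theorem coord_pow (h : IsShiftBasis e φ) (hT : IsBilateralWeightedShift e w T) (j : ℤ) (n : ℕ)
    (x : X) : φ j ((T ^ n) x) = weightProd w (j + n) n * φ (j + n) x := by
  have : (φ j).comp (T ^ n) = weightProd w (j + n) n • φ (j + n) := by
    refine ContinuousLinearMap.ext_on h.dense_span ?_
    rintro _ ⟨m, rfl⟩
    by_cases hm : j + n = m
    · subst hm
      simp [hT.pow_apply, h.coord_unit_self]
    · have hm' : j ≠ m - n := fun h => hm (by omega)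
      simp [hT.pow_apply, h.coord_unit_ne _ _ hm, h.coord_unit_ne _ _ hm']
  exact congrArg (fun L : X →L[ℂ] ℂ => L x) this

theorem norm_weight_le (h : IsShiftBasis e φ) (hT : IsBilateralWeightedShift e w T) (n : ℤ) :
    ‖w n‖ ≤ ‖T‖ := by
  simpa [hT n, norm_smul, h.norm_unit] using T.le_opNorm (e n)

theorem norm_pow_unit (h : IsShiftBasis e φ) (hT : IsBilateralWeightedShift e w T) (m : ℤ)
    (n : ℕ) : ‖(T ^ n) (e m)‖ = ‖weightProd w m n‖ := by
  rw [hT.pow_apply, norm_smul, h.norm_unit, mul_one]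

theorem separableSpace (h : IsShiftBasis e φ) : TopologicalSpace.SeparableSpace X := by
  have := (Set.countable_range e).isSeparable.span (R := ℂ)
  have := this.closure
  rw [h.dense_span.closure_eq] at this
  exact TopologicalSpace.isSeparable_univ_iff.1 this

theorem nontrivial (h : IsShiftBasis e φ) : Nontrivial X :=
  ⟨e 0, 0, fun h0 => by simpa [h0] using h.norm_unit 0⟩

/-- Along suitable powers of a hypercyclic shift, finitely many unit vectors are nearly annihilated
and are, at the same time, nearly images of zero. -/
theorem exists_weightProd_small (h : IsShiftBasis e φ) (hT : IsBilateralWeightedShift e w T)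
    (hcyc : IsHypercyclic T) (J : Finset ℤ) {ε : ℝ} (hε : 0 < ε) :
    ∃ n : ℕ, 1 ≤ n ∧ ∀ j ∈ J, ‖weightProd w j n‖ < ε ∧ weightProd w (j + n) n ≠ 0 ∧
      ‖(weightProd w (j + n) n)⁻¹‖ < ε := by
  have := h.nontrivial
  obtain ⟨x, hx⟩ := hcyc
  set y : X := ∑ j ∈ J, e j with hy
  have hyJ : ∀ j ∈ J, φ j y = 1 := fun j hj => by
    rw [hy, map_sum, Finset.sum_eq_single_of_mem j hj fun k _ hk => h.coord_unit_ne _ _ hk.symm,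
      h.coord_unit_self]
  have hyN : ∀ j ∉ J, φ j y = 0 := fun j hj => by
    rw [hy, map_sum]
    exact Finset.sum_eq_zero fun k hk => h.coord_unit_ne _ _ fun hjk => hj (hjk ▸ hk)
  -- With `δ < 1 / 2`, coordinates within `δ` of one exceed `1 / 2` in modulus; dividing an error
  -- `δ` by them gives at most `2 * δ ≤ ε`.
  obtain ⟨δ, hδ0, hδ1, hδε⟩ : ∃ δ : ℝ, 0 < δ ∧ δ < 1 / 2 ∧ 2 * δ ≤ ε :=
    ⟨min (1 / 4) (ε / 2), by positivity, (min_le_left _ _).trans_lt (by norm_num),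
      by linarith [min_le_right (1 / 4) (ε / 2)]⟩
  classical
  have hperf : ∀ u : X, (𝓝[≠] u).NeBot := Module.punctured_nhds_neBot ℂ X
  -- There are no isolated points, so discarding the first iterates keeps the orbit dense and visits
  -- occur at arbitrarily late times.
  have hvisit : ∀ N : ℕ, ∃ n ≥ N, ‖(T ^ n) x - y‖ < δ := fun N => by
    have hd : Dense ({u : X | ∃ n : ℕ, 1 ≤ n ∧ u = (T ^ n) x} \
        ((Finset.range N).image fun n => (T ^ n) x : Finset X)) := hx.sdiff_finset _
    obtain ⟨u, ⟨⟨n, -, rfl⟩, hn⟩, hu⟩ := hd.exists_dist_lt y hδ0 |>.imp fun u hu => hu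
    refine ⟨n, ?_, by rwa [dist_eq_norm, norm_sub_rev] at hu⟩
    by_contra! hlt
    exact hn (by simpa using ⟨n, hlt, rfl⟩)
  obtain ⟨a, -, ha⟩ := hvisit 0
  set x' := (T ^ a) x with hx'
  obtain ⟨N, hN⟩ : ∃ N : ℕ, ∀ j ∈ J, ∀ i ∈ J, j - i < N ∧ i - j < N := by
    refine ⟨J.sup Int.natAbs + J.sup Int.natAbs + 1, fun j hj i hi => ?_⟩
    have h1 := Finset.le_sup (f := Int.natAbs) hj
    have h2 := Finset.le_sup (f := Int.natAbs) hi
    omega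
  obtain ⟨b, hb, hbx⟩ := hvisit (a + N + 1)
  obtain ⟨n, rfl⟩ := Nat.exists_eq_add_of_le (show a ≤ b by omega)
  have hpow : (T ^ (a + n)) x = (T ^ n) x' := by
    rw [add_comm, pow_add]
    rfl
  rw [hpow] at hbx
  have hcoord : ∀ j, ‖φ j x' - φ j y‖ < δ := fun j => by
    rw [← map_sub]
    exact (h.norm_coord_le _ _).trans_lt ha
  have hcoord' : ∀ j, ‖weightProd w (j + n) n * φ (j + n) x' - φ j y‖ < δ := fun j => by
    rw [← h.coord_pow hT, ← map_sub]
    exact (h.norm_coord_le _ _).trans_lt hbx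
  -- Both `x'` and `(T ^ n) x'` are close to `y`, and `n` exceeds the diameter of `J`. Thus `j - n`
  -- and `j + n` lie outside `J`: the product from `j` sends a coordinate near one to one near zero,
  -- and the product from `j + n` does the reverse.
  refine ⟨n, by omega, fun j hj => ?_⟩
  have hout1 : j + n ∉ J := fun hi => by have := (hN j hj _ hi).2; omega
  have hout2 : j - n ∉ J := fun hi => by have := (hN j hj _ hi).1; omega
  have c1 := hcoord j
  have c2 := hcoord (j + n)
  have c3 := hcoord' j
  have c4 := hcoord' (j - n)
  rw [hyJ j hj] at c1 c3
  rw [hyN _ hout1, sub_zero] at c2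
  rw [hyN _ hout2, sub_zero, sub_add_cancel, norm_mul] at c4
  have d1 : 1 / 2 < ‖φ j x'‖ := by
    have := norm_sub_norm_le (1 : ℂ) (φ j x')
    rw [norm_sub_rev, norm_one] at this
    linarith
  have d3 : 1 / 2 < ‖weightProd w (j + n) n‖ * ‖φ (j + n) x'‖ := by
    have := norm_sub_norm_le (1 : ℂ) (weightProd w (j + n) n * φ (j + n) x')
    rw [norm_sub_rev, norm_one, norm_mul] at this
    linarith
  have d4 : weightProd w (j + n) n ≠ 0 := fun h0 => by
    rw [h0, norm_zero, zero_mul] at d3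
    linarith
  have d5 : 0 < ‖weightProd w (j + n) n‖ := norm_pos_iff.2 d4
  refine ⟨?_, d4, ?_⟩
  · nlinarith [norm_nonneg (weightProd w j n)]
  · rw [norm_inv, inv_lt_iff_one_lt_mul₀ d5]
    nlinarith

/-- The Hypercyclicity Criterion holds for a hypercyclic shift on the span of the unit vectors. -/
theorem exists_criterion_seq (h : IsShiftBasis e φ) (hT : IsBilateralWeightedShift e w T)
    (hcyc : IsHypercyclic T) : ∃ ν : ℕ → ℕ, (∀ q, 1 ≤ ν q) ∧
      (∀ f ∈ Submodule.span ℂ (Set.range e), Tendsto (fun q => (T ^ ν q) f) atTop (𝓝 0)) ∧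
      ∀ f ∈ Submodule.span ℂ (Set.range e), ∃ z : ℕ → X,
        (∀ q, z q ∈ Submodule.span ℂ (Set.range e)) ∧
        (∀ᶠ q in atTop, (T ^ ν q) (z q) = f) ∧ Tendsto z atTop (𝓝 0) := by
  -- The windows exhaust `ℤ` while the tolerance tends to zero, so each fixed index is eventually
  -- covered.
  choose ν hν1 hν using fun q : ℕ => h.exists_weightProd_small hT hcyc (Finset.Icc (-q : ℤ) q)
    (ε := 1 / ((q : ℝ) + 1)) (by positivity)
  have hmem : ∀ j : ℤ, ∀ᶠ q : ℕ in atTop, j ∈ Finset.Icc (-q : ℤ) q := fun j => by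
    filter_upwards [eventually_ge_atTop j.natAbs] with q hq
    rw [Finset.mem_Icc]
    omega
  refine ⟨ν, hν1, fun f hf => ?_, fun f hf => ?_⟩
  · induction hf using Submodule.span_induction with
    | mem f hf =>
      obtain ⟨j, rfl⟩ := hf
      refine squeeze_zero_norm' ?_ tendsto_one_div_add_atTop_nhds_zero_nat
      filter_upwards [hmem j] with q hq
      rw [h.norm_pow_unit hT]
      exact (hν q j hq).1.le
    | zero => simp
    | add f g _ _ hf hg => simpa using hf.add hg
    | smul c f _ hf => simpa using hf.const_smul c
  · induction hf using Submodule.span_induction with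
    | mem f hf =>
      obtain ⟨j, rfl⟩ := hf
      refine ⟨fun q => (weightProd w (j + ν q) (ν q))⁻¹ • e (j + ν q),
        fun q => Submodule.smul_mem _ _ (Submodule.subset_span ⟨_, rfl⟩), ?_, ?_⟩
      · filter_upwards [hmem j] with q hq
        rw [map_smul, hT.pow_apply, smul_smul, inv_mul_cancel₀ (hν q j hq).2.1, one_smul,
          add_sub_cancel_right]
      · refine squeeze_zero_norm' ?_ tendsto_one_div_add_atTop_nhds_zero_nat
        filter_upwards [hmem j] with q hq
        rw [norm_smul, h.norm_unit, mul_one]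
        exact (hν q j hq).2.2.le
    | zero => exact ⟨0, fun _ => Submodule.zero_mem _, by simp, tendsto_const_nhds⟩
    | add f g _ _ hf hg =>
      obtain ⟨z, hz, hzf, hz0⟩ := hf
      obtain ⟨u, hu, hug, hu0⟩ := hg
      refine ⟨z + u, fun q => Submodule.add_mem _ (hz q) (hu q), ?_, (hz0.add hu0).trans (by simp)⟩
      filter_upwards [hzf, hug] with q h1 h2
      rw [Pi.add_apply, map_add, h1, h2]
    | smul c f _ hf =>
      obtain ⟨z, hz, hzf, hz0⟩ := hf
      refine ⟨c • z, fun q => Submodule.smul_mem _ _ (hz q), ?_, (hz0.const_smul c).trans (by simp)⟩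
      filter_upwards [hzf] with q h1
      rw [Pi.smul_apply, map_smul, h1]

/-- A power of the shift that does not increase the norm of any `e (m i)` is a contraction on the
closed span of the `e (m i)`. -/
theorem norm_pow_le_of_mem (h : IsShiftBasis e φ) (hT : IsBilateralWeightedShift e w T)
    {m : ℕ → ℤ} {n : ℕ} (hmn : ∀ i, ‖(T ^ n) (e (m i))‖ ≤ 1) {x : X}
    (hx : ∀ j ∉ Set.range m, φ j x = 0) : ‖(T ^ n) x‖ ≤ ‖x‖ := by
  refine h.norm_le_norm n _ _ fun j => ?_
  rw [h.coord_pow hT, norm_mul]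
  by_cases hj : j + n ∈ Set.range m
  · obtain ⟨i, hi⟩ := hj
    have := hmn i
    rw [h.norm_pow_unit hT, hi] at this
    exact mul_le_of_le_one_left (norm_nonneg _) this
  · simp [hx _ hj]

theorem coord_eq_zero_of_mem_closure_span (h : IsShiftBasis e φ) {m : ℕ → ℤ} {x : X}
    (hx : x ∈ (Submodule.span ℂ (Set.range (e ∘ m))).topologicalClosure) {j : ℤ}
    (hj : j ∉ Set.range m) : φ j x = 0 := by
  have hle : (Submodule.span ℂ (Set.range (e ∘ m))).topologicalClosure ≤ (φ j).ker := by
    refine Submodule.topologicalClosure_minimal _ (Submodule.span_le.2 ?_) (φ j).isClosed_ker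
    rintro _ ⟨i, rfl⟩
    exact h.coord_unit_ne _ _ fun hji => hj ⟨i, hji.symm⟩
  exact hle hx

theorem linearIndependent (h : IsShiftBasis e φ) : LinearIndependent ℂ e := by
  rw [linearIndependent_iff']
  intro s g hg i hi
  have := congrArg (φ i) hg
  rw [map_sum, Finset.sum_eq_single_of_mem i hi fun j _ hj => by
    rw [map_smul, h.coord_unit_ne _ _ hj.symm, smul_zero], map_smul, h.coord_unit_self] at this
  simpa using this

/-- The powers are uniformly contractive on this closed span, so convergence passes from the span to
its closure. -/
theorem tendsto_pow_of_mem_closure_span (h : IsShiftBasis e φ)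
    (hT : IsBilateralWeightedShift e w T) {m : ℕ → ℤ} {n : ℕ → ℕ}
    (hmn : ∀ k i, ‖(T ^ n k) (e (m i))‖ ≤ 1)
    (hlim : ∀ i, Tendsto (fun k => (T ^ n k) (e (m i))) atTop (𝓝 0)) {x : X}
    (hx : x ∈ (Submodule.span ℂ (Set.range (e ∘ m))).topologicalClosure) :
    Tendsto (fun k => (T ^ n k) x) atTop (𝓝 0) := by
  have hspan : ∀ y ∈ Submodule.span ℂ (Set.range (e ∘ m)),
      Tendsto (fun k => (T ^ n k) y) atTop (𝓝 0) := fun y hy => by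
    induction hy using Submodule.span_induction with
    | mem y hy =>
      obtain ⟨i, rfl⟩ := hy
      exact hlim i
    | zero => simp
    | add f g _ _ hf hg => simpa using hf.add hg
    | smul c f _ hf => simpa using hf.const_smul c
  rw [Metric.tendsto_atTop]
  intro ε hε
  obtain ⟨y, hy, hxy⟩ := Metric.mem_closure_iff.1 hx (ε / 2) (half_pos hε)
  obtain ⟨N, hN⟩ := Metric.tendsto_atTop.1 (hspan y hy) (ε / 2) (half_pos hε)
  refine ⟨N, fun k hk => ?_⟩
  have h1 := hN k hk
  have h2 : ‖(T ^ n k) (x - y)‖ ≤ ‖x - y‖ := h.norm_pow_le_of_mem hT (hmn k) fun j hj =>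
    h.coord_eq_zero_of_mem_closure_span
      (Submodule.sub_mem _ hx (Submodule.le_topologicalClosure _ hy)) hj
  rw [dist_zero_right] at h1 ⊢
  rw [dist_eq_norm] at hxy
  calc ‖(T ^ n k) x‖ = ‖(T ^ n k) (x - y) + (T ^ n k) y‖ := by rw [← map_add, sub_add_cancel]
    _ ≤ ‖(T ^ n k) (x - y)‖ + ‖(T ^ n k) y‖ := norm_add_le _ _
    _ < ε := by linarith

variable [CompleteSpace X]

theorem hasHypercyclicSubspace (h : IsShiftBasis e φ) (hT : IsBilateralWeightedShift e w T)
    (hcyc : IsHypercyclic T) : HasHypercyclicSubspace T := by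
  have := h.separableSpace
  have : SecondCountableTopology X := UniformSpace.secondCountable_of_separable X
  set D := Submodule.span ℂ (Set.range e) with hD
  obtain ⟨ν, hν1, hν0, hνz⟩ := h.exists_criterion_seq hT hcyc
  let d : ℕ → X := fun l => (TopologicalSpace.denseSeq D l : X)
  have hd : DenseRange d := h.dense_span.denseRange_val.comp
    (TopologicalSpace.denseRange_denseSeq D) continuous_subtype_val
  have hdD : ∀ l, d l ∈ D := fun l => (TopologicalSpace.denseSeq D l).2
  let δ : ℕ → ℝ := fun k => (1 / 4) ^ (k + 1)
  have hδ : ∀ k, 0 < δ k := fun k => by positivity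
  have hδ1 : ∀ k, δ k ≤ 1 := fun k => pow_le_one₀ (by norm_num) (by norm_num)
  -- The ratio `1 / 4` splits into two factors `1 / 2`, so a bound by the later index alone yields
  -- decay in both indices.
  have hδ' : ∀ j k, j ≤ k → δ k ≤ (1 / 2) ^ (k + 1) * (1 / 2) ^ (j + 1) := fun j k hjk => by
    have h1 : δ k = (1 / 2) ^ (k + 1) * (1 / 2) ^ (k + 1) := by
      rw [← mul_pow]
      norm_num [δ]
    rw [h1]
    exact mul_le_mul_of_nonneg_left
      (pow_le_pow_of_le_one (by norm_num) (by norm_num) (by omega)) (by positivity)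
  -- A term bundles an index, a power and a vector. The side conditions are carried along because
  -- later choices need positive powers and vectors in `D`.
  let α := {s : ℤ × ℕ × X // 1 ≤ s.2.1 ∧ s.2.2 ∈ D}
  have hsmall : ∀ (m : ℤ) (ε : ℝ), 0 < ε → ∃ n, ‖weightProd w m n‖ < ε := fun m ε hε => by
    obtain ⟨n, -, hn⟩ := h.exists_weightProd_small hT hcyc {m} hε
    exact ⟨n, (hn m (Finset.mem_singleton_self m)).1⟩
  obtain ⟨f, hfR, hfr⟩ := exists_seq_forall_finset (α := α)
    (fun k y => (T ^ y.1.2.1) y.1.2.2 = d k.unpair.2.unpair.1 ∧ ‖y.1.2.2‖ ≤ δ k ∧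
      ‖(T ^ y.1.2.1) (e y.1.1)‖ ≤ δ k)
    (fun k x y => y.1.1 < x.1.1 ∧ ‖(T ^ x.1.2.1) (e y.1.1)‖ ≤ 1 ∧
      ‖(T ^ y.1.2.1) (e x.1.1)‖ ≤ δ k ∧ ‖(T ^ y.1.2.1) x.1.2.2‖ ≤ δ k ∧
      ‖(T ^ x.1.2.1) y.1.2.2‖ ≤ δ k) (by
    intro k s
    obtain ⟨M, hM⟩ : ∃ M : ℤ, ∀ x ∈ s, M ≤ x.1.1 := by
      obtain ⟨M, hM⟩ := (s.finite_toSet.image fun x : α => x.1.1).bddBelow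
      exact ⟨M, fun x hx => hM ⟨x, hx, rfl⟩⟩
    -- The order matters: `m` is fixed first, against the earlier powers; every other requirement,
    -- including smallness of `(T ^ ν q) (e m)`, then holds for all large `q`.
    obtain ⟨m, hmM, hm⟩ := exists_weightProd_le_one (h.norm_weight_le hT) hsmall
      (s.image fun x => x.1.2.1) (by
        intro n hn
        obtain ⟨x, -, rfl⟩ := Finset.mem_image.1 hn
        exact x.2.1) M
    obtain ⟨z, hzD, hzd, hz0⟩ := hνz _ (hdD k.unpair.2.unpair.1)
    have small : ∀ {u : ℕ → X}, Tendsto u atTop (𝓝 0) → ∀ᶠ q in atTop, ‖u q‖ ≤ δ k :=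
      fun hu => (hu.norm.eventually_lt_const (by simpa using hδ k)).mono fun _ => le_of_lt
    have he : ∀ j, Tendsto (fun q => (T ^ ν q) (e j)) atTop (𝓝 0) :=
      fun j => hν0 _ (Submodule.subset_span ⟨j, rfl⟩)
    have ev : ∀ᶠ q in atTop, ∀ x ∈ s, ‖(T ^ ν q) (e x.1.1)‖ ≤ δ k ∧
        ‖(T ^ ν q) x.1.2.2‖ ≤ δ k ∧ ‖(T ^ x.1.2.1) (z q)‖ ≤ δ k := by
      rw [Filter.eventually_all_finset]
      intro x _
      refine (small (he _)).and ((small (hν0 _ x.2.2)).and (small ?_))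
      exact (map_zero (T ^ x.1.2.1)) ▸ ((T ^ x.1.2.1).continuous.tendsto 0).comp hz0
    obtain ⟨q, hq1, hq2, hq3, hq4⟩ := (hzd.and ((small hz0).and ((small (he m)).and ev))).exists
    refine ⟨⟨(m, ν q, z q), hν1 q, hzD q⟩, ⟨hq1, hq2, hq3⟩, fun x hx =>
      ⟨hmM.trans_le (hM x hx), ?_, hq4 x hx⟩⟩
    rw [h.norm_pow_unit hT]
    exact hm _ (Finset.mem_image_of_mem _ hx))
  let m : ℕ → ℤ := fun k => (f k).1.1
  have hanti : StrictAnti m := fun j k hjk => (hfr j k hjk).1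
  refine hasHypercyclicSubspace_of_perturbation
    (E := (Submodule.span ℂ (Set.range (e ∘ m))).topologicalClosure) (φ := fun i => φ (m i))
    (n := fun k => (f k).1.2.1) (z := fun k => (f k).1.2.2)
    (Submodule.isClosed_topologicalClosure _) (fun hfin => ?_) (fun i x => h.norm_coord_le _ x)
    (fun x hx h0 => h.eq_zero fun j => ?_) (fun k => (f k).2.1)
    (fun x hx => h.tendsto_pow_of_mem_closure_span hT (fun k i => ?_) (fun i => ?_) hx)
    hd (fun k => (hfR k).2.1) (fun k => (hfR k).1) (fun j k hjk => ?_)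
  · have := Submodule.finiteDimensional_of_le
      (Submodule.le_topologicalClosure (Submodule.span ℂ (Set.range (e ∘ m))))
    have hli := linearIndependent_span (h.linearIndependent.comp m hanti.injective)
    exact not_finite_iff_infinite.2 (inferInstance : Infinite ℕ) hli.finite
  · by_cases hj : j ∈ Set.range m
    · obtain ⟨i, rfl⟩ := hj
      exact h0 i
    · exact h.coord_eq_zero_of_mem_closure_span hx hj
  -- For `i ≤ k` the new power was chosen to shrink known vectors; for `k < i` the index `m i` was
  -- placed far enough left to respect the old power.
  · rcases lt_trichotomy i k with hik | rfl | hki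
    · exact (hfr i k hik).2.2.1.trans (hδ1 k)
    · exact (hfR i).2.2.trans (hδ1 i)
    · exact (hfr k i hki).2.1
  · refine squeeze_zero_norm' ?_ hasSum_quarter_pow_succ.summable.tendsto_atTop_zero
    filter_upwards [eventually_gt_atTop i] with k hk
    exact (hfr i k hk).2.2.1
  · rcases lt_or_gt_of_ne hjk with hjk | hkj
    · exact (hfr j k hjk).2.2.2.1.trans (hδ' j k hjk.le)
    · exact ((hfr k j hkj).2.2.2.2.trans (hδ' k j hkj.le)).trans_eq (mul_comm _ _)

end IsShiftBasis

end ShiftBasis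

/-! ### The sequence spaces -/

section Unweighted

/-- Translation permutes `ℤ`, so it leaves the sum of `p`-th powers unchanged. -/
theorem lp_norm_le_norm_of_shift {p : ℝ≥0∞} (hp : 0 < p.toReal) (k : ℤ)
    {x y : lp (fun _ : ℤ => ℂ) p} (hxy : ∀ n, ‖x n‖ ≤ ‖y (n + k)‖) : ‖x‖ ≤ ‖y‖ := by
  have hx : Summable fun n => ‖x n‖ ^ p.toReal := (lp.memℓp x).summable hp
  have hy : Summable fun n => ‖y (n + k)‖ ^ p.toReal :=
    ((lp.memℓp y).summable hp).comp_injective (Equiv.addRight k).injective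
  have hle : ∑' n, ‖x n‖ ^ p.toReal ≤ ∑' n, ‖y n‖ ^ p.toReal :=
    (hx.tsum_le_tsum (fun n => Real.rpow_le_rpow (norm_nonneg _) (hxy n) hp.le) hy).trans_eq
      ((Equiv.addRight k).tsum_eq fun n => ‖y n‖ ^ p.toReal)
  rw [lp.norm_eq_tsum_rpow hp, lp.norm_eq_tsum_rpow hp]
  exact Real.rpow_le_rpow (tsum_nonneg fun n => Real.rpow_nonneg (norm_nonneg _) _) hle
    (one_div_nonneg.2 hp.le)

theorem isShiftBasis_lpUnit (p : ℝ≥0) [Fact (1 ≤ (p : ℝ≥0∞))] :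
    IsShiftBasis (lpUnit p) (fun n => lp.evalCLM ℂ (fun _ : ℤ => ℂ) (p : ℝ≥0∞) n) := by
  have hp : 1 ≤ (p : ℝ≥0∞) := Fact.out
  have hp1 : (0 : ℝ≥0∞) < p := zero_lt_one.trans_le hp
  have hp0 : 0 < (p : ℝ≥0∞).toReal := ENNReal.toReal_pos hp1.ne' ENNReal.coe_ne_top
  have hdense : ∀ x : lp (fun _ : ℤ => ℂ) (p : ℝ≥0∞), HasSum (fun n => x n • lpUnit p n) x := by
    intro x
    convert lp.hasSum_single ENNReal.coe_ne_top x using 2 with n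
    rw [lpUnit, ← lp.single_smul, smul_eq_mul, mul_one]
  refine ⟨fun n => lp.single_apply_self p n _, fun m n hmn => lp.single_apply_ne p n _ hmn,
    fun n => ?_, fun n x => lp.norm_apply_le_norm hp1.ne' x n, fun x => ?_,
    fun k x y hxy => ?_⟩
  · rw [lpUnit, lp.norm_single hp1, norm_one]
  · exact mem_closure_of_tendsto (hdense x) (Eventually.of_forall fun s =>
      Submodule.sum_mem _ fun n _ => Submodule.smul_mem _ _ (Submodule.subset_span ⟨n, rfl⟩))
  · exact lp_norm_le_norm_of_shift hp0 k hxy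

theorem norm_apply_le_norm_c0 (x : C₀(ℤ, ℂ)) (n : ℤ) : ‖x n‖ ≤ ‖x‖ :=
  x.toBCF.norm_coe_le_norm n

/-- The coordinate functionals of `c₀(ℤ)`. -/
noncomputable def c0Coord (n : ℤ) : C₀(ℤ, ℂ) →L[ℂ] ℂ :=
  LinearMap.mkContinuous
    { toFun := fun x => x n
      map_add' := fun _ _ => rfl
      map_smul' := fun _ _ => rfl } 1
    fun x => by simpa using norm_apply_le_norm_c0 x n

theorem c0Coord_apply (n : ℤ) (x : C₀(ℤ, ℂ)) : c0Coord n x = x n := rfl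

theorem norm_c0_le {x : C₀(ℤ, ℂ)} {C : ℝ} (hC : 0 ≤ C) (h : ∀ n, ‖x n‖ ≤ C) : ‖x‖ ≤ C :=
  (BoundedContinuousFunction.norm_le hC).2 h

theorem c0Coord_c0Unit_self (n : ℤ) : c0Coord n (c0Unit n) = 1 := Pi.single_eq_same n 1

theorem c0Coord_c0Unit_ne {m n : ℤ} (h : m ≠ n) : c0Coord m (c0Unit n) = 0 :=
  Pi.single_eq_of_ne h 1

theorem tendsto_c0Coord (x : C₀(ℤ, ℂ)) : Tendsto (fun n => c0Coord n x) cofinite (𝓝 0) := by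
  rw [← cocompact_eq_cofinite]
  exact x.zero_at_infty'

theorem isShiftBasis_c0Unit : IsShiftBasis c0Unit c0Coord := by
  refine ⟨c0Coord_c0Unit_self, fun m n => c0Coord_c0Unit_ne, fun n => le_antisymm ?_ ?_,
    fun n x => norm_apply_le_norm_c0 x n, fun x => ?_, fun k x y hxy => ?_⟩
  · refine norm_c0_le zero_le_one fun m => ?_
    rw [← c0Coord_apply]
    by_cases h : m = n
    · rw [h, c0Coord_c0Unit_self, norm_one]
    · rw [c0Coord_c0Unit_ne h, norm_zero]
      exact zero_le_one
  · have := norm_apply_le_norm_c0 (c0Unit n) n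
    rwa [← c0Coord_apply, c0Coord_c0Unit_self, norm_one] at this
  · refine Metric.mem_closure_iff.2 fun ε hε => ?_
    -- Truncation to the finitely many large coordinates leaves an error of norm at most `ε / 2`.
    have hfin : {n | ¬ ‖c0Coord n x‖ < ε / 2}.Finite :=
      (tendsto_c0Coord x).norm.eventually_lt_const (by simpa using half_pos hε)
    refine ⟨∑ n ∈ hfin.toFinset, c0Coord n x • c0Unit n, Submodule.sum_mem _ fun n _ =>
      Submodule.smul_mem _ _ (Submodule.subset_span ⟨n, rfl⟩), ?_⟩
    rw [dist_eq_norm]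
    refine (norm_c0_le (half_pos hε).le fun m => ?_).trans_lt (half_lt_self hε)
    rw [← c0Coord_apply, map_sub, map_sum]
    by_cases hm : m ∈ hfin.toFinset
    · rw [Finset.sum_eq_single_of_mem m hm fun j _ hj => by
        rw [map_smul, c0Coord_c0Unit_ne hj.symm, smul_zero], map_smul, c0Coord_c0Unit_self]
      simpa using (half_pos hε).le
    · rw [Finset.sum_eq_zero fun j hj => by
        rw [map_smul, c0Coord_c0Unit_ne (ne_of_mem_of_not_mem hj hm).symm, smul_zero], sub_zero]
      exact (not_not.1 fun h => hm (hfin.mem_toFinset.2 h)).le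
  · exact norm_c0_le (norm_nonneg _) fun n => (hxy n).trans (norm_apply_le_norm_c0 y _)

end Unweighted

/-! ### Transfer of hypercyclic subspaces along isomorphisms. -/

section Transfer

variable {X Y : Type*} [NormedAddCommGroup X] [NormedSpace ℂ X] [NormedAddCommGroup Y]
  [NormedSpace ℂ Y]

theorem conj_pow_apply (U : X ≃L[ℂ] Y) (T : X →L[ℂ] X) (n : ℕ) (x : X) :
    (((U : X →L[ℂ] Y) ∘L T ∘L (U.symm : Y →L[ℂ] X)) ^ n) (U x) = U ((T ^ n) x) := by
  induction n with
  | zero => simp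
  | succ n ih =>
    rw [pow_succ', mul_apply_eq_comp, ih, pow_succ',
      mul_apply_eq_comp]
    simp

theorem isHypercyclicVector_conj_iff (U : X ≃L[ℂ] Y) (T : X →L[ℂ] X) (x : X) :
    IsHypercyclicVector ((U : X →L[ℂ] Y) ∘L T ∘L (U.symm : Y →L[ℂ] X)) (U x) ↔
      IsHypercyclicVector T x := by
  have : {y : Y | ∃ n : ℕ, 1 ≤ n ∧ y = (((U : X →L[ℂ] Y) ∘L T ∘L (U.symm : Y →L[ℂ] X)) ^ n) (U x)} =
      U.toHomeomorph '' {y : X | ∃ n : ℕ, 1 ≤ n ∧ y = (T ^ n) x} := by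
    ext y
    simp only [conj_pow_apply]
    constructor
    · rintro ⟨n, hn, rfl⟩
      exact ⟨_, ⟨n, hn, rfl⟩, rfl⟩
    · rintro ⟨_, ⟨n, hn, rfl⟩, rfl⟩
      exact ⟨n, hn, rfl⟩
  rw [IsHypercyclicVector, IsHypercyclicVector, this]
  exact U.toHomeomorph.isDenseEmbedding.dense_image

/-- The shift property and hypercyclicity pass along an isomorphism that rescales the unit
vectors, and hypercyclic subspaces can be pulled back. -/
theorem hasHypercyclicSubspace_of_equiv [CompleteSpace Y] {e : ℤ → X} {f : ℤ → Y}
    {φ : ℤ → Y →L[ℂ] ℂ} (hf : IsShiftBasis f φ) (U : X ≃L[ℂ] Y) {a : ℤ → ℂ} (ha : ∀ n, a n ≠ 0)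
    (hU : ∀ n, U (e n) = a n • f n) {w : ℤ → ℂ} {T : X →L[ℂ] X}
    (hT : IsBilateralWeightedShift e w T) (hcyc : IsHypercyclic T) : HasHypercyclicSubspace T := by
  set S := (U : X →L[ℂ] Y) ∘L T ∘L (U.symm : Y →L[ℂ] X) with hS
  -- Conjugation keeps the shift form; the rescaling of the unit vectors is absorbed into new
  -- weights.
  have hS' : IsBilateralWeightedShift f (fun n => (a n)⁻¹ * (w n * a (n - 1))) S := fun n => by
    have h1 : f n = U ((a n)⁻¹ • e n) := by
      rw [map_smul, hU, smul_smul, inv_mul_cancel₀ (ha n), one_smul]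
    calc S (f n) = U (T ((a n)⁻¹ • e n)) := by rw [h1]; simp [hS]
      _ = _ := by simp only [map_smul, hT n, hU, smul_smul]; ring_nf
  obtain ⟨x, hx⟩ := hcyc
  obtain ⟨M, hMc, hMi, hM⟩ := hf.hasHypercyclicSubspace hS'
    ⟨U x, (isHypercyclicVector_conj_iff U T x).2 hx⟩
  refine ⟨M.comap (U : X →ₗ[ℂ] Y), hMc.preimage U.continuous, fun h => hMi ?_,
    fun y hy hy0 => ?_⟩
  · have hmap : (M.comap (U : X →ₗ[ℂ] Y)).map (U : X →ₗ[ℂ] Y) = M :=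
      Submodule.map_comap_eq_of_surjective U.surjective M
    rw [← hmap]
    exact Module.Finite.equiv (U.toLinearEquiv.submoduleMap _)
  · exact (isHypercyclicVector_conj_iff U T y).1
      (hM _ hy fun h0 => hy0 (U.injective (h0.trans (map_zero U).symm)))

end Transfer

/-! ### The weighted spaces as diagonal isometric copies of the unweighted ones. -/

section Weighted

theorem ofReal_mul_inv_mul_cancel {a : ℝ} (ha : 0 < a) (z : ℂ) : (a : ℂ) * ((a : ℂ)⁻¹ * z) = z :=
  mul_inv_cancel_left₀ (by exact_mod_cast ha.ne') z

theorem WeightedLp.toLp_surjective {p : ℝ≥0} [Fact (1 ≤ (p : ℝ≥0∞))] {v : ℤ → ℝ}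
    {hv : ∀ n, 0 < v n} : Function.Surjective (WeightedLp.toLp (p := p) (hv := hv)) := by
  intro y
  have hy : (fun n => ((v n ^ (1 / (p : ℝ)) : ℝ) : ℂ) *
      (((v n ^ (1 / (p : ℝ)) : ℝ) : ℂ)⁻¹ * y n)) = y :=
    funext fun n => ofReal_mul_inv_mul_cancel (Real.rpow_pos_of_pos (hv n) _) _
  refine ⟨⟨fun n => ((v n ^ (1 / (p : ℝ)) : ℝ) : ℂ)⁻¹ * y n, ?_⟩, ?_⟩
  · refine (memℓp_weight_iff hv _).1 ?_
    rw [hy]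
    exact lp.memℓp y
  · exact Subtype.ext hy

/-- The isometric isomorphism `x ↦ (v n ^ (1 / p) * x n)` of `ℓ^p(v, ℤ)` onto `ℓ^p(ℤ)`. -/
noncomputable def WeightedLp.equivLp (p : ℝ≥0) [Fact (1 ≤ (p : ℝ≥0∞))] {v : ℤ → ℝ} (hv : ∀ n, 0 < v n) :
    WeightedLp p hv ≃ₗᵢ[ℂ] lp (fun _ : ℤ => ℂ) (p : ℝ≥0∞) :=
  LinearIsometryEquiv.ofSurjective ⟨WeightedLp.toLp, WeightedLp.norm_toLp⟩
    WeightedLp.toLp_surjective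

theorem WeightedLp.equivLp_unit (p : ℝ≥0) [Fact (1 ≤ (p : ℝ≥0∞))] {v : ℤ → ℝ}
    (hv : ∀ n, 0 < v n) (n : ℤ) : WeightedLp.equivLp p hv (WeightedLp.unit p hv n) =
      ((v n ^ (1 / (p : ℝ)) : ℝ) : ℂ) • lpUnit p n := by
  ext m
  change ((v m ^ (1 / (p : ℝ)) : ℝ) : ℂ) * (Pi.single n 1 : ℤ → ℂ) m =
    ((v n ^ (1 / (p : ℝ)) : ℝ) : ℂ) * (Pi.single n 1 : ℤ → ℂ) m
  by_cases h : m = n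
  · rw [h]
  · simp [h]

theorem WeightedC0.toC0_surjective {v : ℤ → ℝ} {hv : ∀ n, 0 < v n} :
    Function.Surjective (WeightedC0.toC0 (hv := hv)) := by
  intro y
  have hy : ∀ n, (v n : ℂ) * ((v n : ℂ)⁻¹ * y n) = y n :=
    fun n => ofReal_mul_inv_mul_cancel (hv n) _
  refine ⟨⟨fun n => (v n : ℂ)⁻¹ * y n, ?_⟩, ZeroAtInftyContinuousMap.ext hy⟩
  change Tendsto _ _ _
  rw [← Int.cofinite_eq]
  refine Tendsto.congr (fun n => ?_) (tendsto_zero_iff_norm_tendsto_zero.1 (tendsto_c0Coord y))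
  rw [← WeightedC0.norm_weight_mul hv (fun n => (v n : ℂ)⁻¹ * y n) n, hy, c0Coord_apply]

/-- The isometric isomorphism `x ↦ (v n * x n)` of `c₀(v, ℤ)` onto `c₀(ℤ)`. -/
noncomputable def WeightedC0.equivC0 {v : ℤ → ℝ} (hv : ∀ n, 0 < v n) : WeightedC0 hv ≃ₗᵢ[ℂ] C₀(ℤ, ℂ) :=
  LinearIsometryEquiv.ofSurjective ⟨WeightedC0.toC0, WeightedC0.norm_toC0⟩
    WeightedC0.toC0_surjective

theorem WeightedC0.equivC0_unit {v : ℤ → ℝ} (hv : ∀ n, 0 < v n) (n : ℤ) :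
    WeightedC0.equivC0 hv (WeightedC0.unit hv n) = (v n : ℂ) • c0Unit n := by
  ext m
  change (v m : ℂ) * (Pi.single n 1 : ℤ → ℂ) m = (v n : ℂ) * (Pi.single n 1 : ℤ → ℂ) m
  by_cases h : m = n
  · rw [h]
  · simp [h]

end Weighted

theorem theorem3p5 :
    (∀ (p : ℝ≥0) [Fact (1 ≤ (p : ℝ≥0∞))] (w : ℤ → ℂ)
      (T : lp (fun _ : ℤ => ℂ) (p : ℝ≥0∞) →L[ℂ] lp (fun _ : ℤ => ℂ) (p : ℝ≥0∞)),
      IsBilateralWeightedShift (lpUnit p) w T → IsHypercyclic T → HasHypercyclicSubspace T) ∧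
    (∀ (w : ℤ → ℂ) (T : C₀(ℤ, ℂ) →L[ℂ] C₀(ℤ, ℂ)),
      IsBilateralWeightedShift c0Unit w T → IsHypercyclic T → HasHypercyclicSubspace T) ∧
    (∀ (p : ℝ≥0) [Fact (1 ≤ (p : ℝ≥0∞))] (v : ℤ → ℝ) (hv : ∀ n, 0 < v n) (w : ℤ → ℂ)
      (T : WeightedLp p hv →L[ℂ] WeightedLp p hv),
      IsBilateralWeightedShift (WeightedLp.unit p hv) w T →
        IsHypercyclic T → HasHypercyclicSubspace T) ∧
    (∀ (v : ℤ → ℝ) (hv : ∀ n, 0 < v n) (w : ℤ → ℂ) (T : WeightedC0 hv →L[ℂ] WeightedC0 hv),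
      IsBilateralWeightedShift (WeightedC0.unit hv) w T →
        IsHypercyclic T → HasHypercyclicSubspace T) := by
  refine ⟨fun p _ w T hT hcyc => (isShiftBasis_lpUnit p).hasHypercyclicSubspace hT hcyc,
    fun w T hT hcyc => isShiftBasis_c0Unit.hasHypercyclicSubspace hT hcyc,
    fun p _ v hv w T hT hcyc => ?_, fun v hv w T hT hcyc => ?_⟩
  · refine hasHypercyclicSubspace_of_equiv (isShiftBasis_lpUnit p)
      (WeightedLp.equivLp p hv).toContinuousLinearEquiv (fun n => ?_)
      (WeightedLp.equivLp_unit p hv) hT hcyc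
    exact_mod_cast (Real.rpow_pos_of_pos (hv n) _).ne'
  · refine hasHypercyclicSubspace_of_equiv isShiftBasis_c0Unit
      (WeightedC0.equivC0 hv).toContinuousLinearEquiv (fun n => ?_)
      (WeightedC0.equivC0_unit hv) hT hcyc
    exact_mod_cast (hv n).ne'
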